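/- Let $G$ be the three-dimensional Heisenberg group of real matrices $$\begin{pmatrix}1&a&c\\0&1&b\\0&0&1\end{pmatrix},$$ with the global coordinates $(x,y,z)$ given by $a=x$, $b=y$, $c=z+\frac{xy}{2}$, and let $\mathrm{Id}=(0,0,0)$ be its identity. Equip $G$ with the left-invariant sub-Riemannian structure for which the vector fields $$X_1=\frac{\partial}{\partial x}-\frac y2\frac{\partial}{\partial z},\qquad X_2=\frac{\partial}{\partial y}+\frac x2\frac{\partial}{\partial z}$$ form an orthonormal frame of the distribution. A Lipschitz curve $q:[0,t_1]\to G$ is horizontal if $\dot q(t)\in\mathrm{span}(X_1(q(t)),X_2(q(t)))$ for almost every $t$; its length is $\int_0^{t_1}\langle\dot q,\dot q\rangle^{1/2}\,dt$, and $d(g_0,g_1)$ is the infimum of the lengths of the horizontal curves from $g_0$ to $g_1$. Let $g=(x,y,z)\in G$ and $r=\sqrt{x^2+y^2}$. Then $g$ can be joined to $\mathrm{Id}$ by a horizontal curve (so $d(\mathrm{Id},g)$ is finite), and $$\sqrt{\frac{\sqrt{r^4+48z^2}+r^2}{2}}\;\le\; d(\mathrm{Id},g)\;\le\;\sqrt{\frac{\sqrt{r^4+64\pi^2z^2}+r^2}{2}}.$$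 As a consequence, $d(\mathrm{Id},g)\ge r$ and $d(\mathrm{Id},g)\ge\sqrt[4]{12z^2}$. -/

import Mathlib

open Set MeasureTheory
open scoped NNReal

/-- The three-dimensional Heisenberg group, in the global coordinates `(x, y, z)` related to the
matrix entries `(a, b, c)` by `a = x`, `b = y`, `c = z + x y / 2` (see `Heisenberg.toMatrix`). -/
@[ext]
structure Heisenberg where
  x : ℝ
  y : ℝ
  z : ℝ

namespace Heisenberg

/-- The upper unitriangular matrix with entries `a`, `b`, `c` represented by a point. -/
noncomputable def toMatrix (g : Heisenberg) : Matrix (Fin 3) (Fin 3) ℝ :=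
  !![1, g.x, g.z + g.x * g.y / 2; 0, 1, g.y; 0, 0, 1]

noncomputable instance : Mul Heisenberg :=
  ⟨fun g h => ⟨g.x + h.x, g.y + h.y, g.z + h.z + (g.x * h.y - g.y * h.x) / 2⟩⟩

instance : One Heisenberg := ⟨⟨0, 0, 0⟩⟩

instance : Inv Heisenberg := ⟨fun g => ⟨-g.x, -g.y, -g.z⟩⟩

theorem mul_def (g h : Heisenberg) :
    g * h = ⟨g.x + h.x, g.y + h.y, g.z + h.z + (g.x * h.y - g.y * h.x) / 2⟩ := rfl

theorem one_def : (1 : Heisenberg) = ⟨0, 0, 0⟩ := rfl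

theorem inv_def (g : Heisenberg) : g⁻¹ = ⟨-g.x, -g.y, -g.z⟩ := rfl

noncomputable instance : Group Heisenberg :=
  Group.ofLeftAxioms
    (by intro a b c; ext <;> simp only [mul_def] <;> ring)
    (by intro a; ext <;> simp only [mul_def, one_def] <;> ring)
    (by intro a; ext <;> simp only [mul_def, one_def, inv_def] <;> ring)

/-- The group law is matrix multiplication. -/
theorem toMatrix_mul (g h : Heisenberg) : (g * h).toMatrix = g.toMatrix * h.toMatrix := by
  ext i j
  fin_cases i <;> fin_cases j <;>
    simp [toMatrix, mul_def, Matrix.mul_apply, Fin.sum_univ_three] <;> ring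

/-- The identity is the identity matrix. -/
theorem toMatrix_one : (1 : Heisenberg).toMatrix = 1 := by
  ext i j
  fin_cases i <;> fin_cases j <;> simp [toMatrix, one_def]

/-- Every upper unitriangular matrix is represented by exactly one point. -/
theorem existsUnique_toMatrix (a b c : ℝ) :
    ∃! g : Heisenberg, g.toMatrix = !![1, a, c; 0, 1, b; 0, 0, 1] := by
  refine ⟨⟨a, b, c - a * b / 2⟩, by simp [toMatrix], ?_⟩
  intro g hg
  have h1 : g.x = a := by simpa [toMatrix] using congrFun (congrFun hg 0) 1
  have h2 : g.y = b := by simpa [toMatrix] using congrFun (congrFun hg 1) 2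
  have h3 : g.z + g.x * g.y / 2 = c := by simpa [toMatrix] using congrFun (congrFun hg 0) 2
  ext
  · exact h1
  · exact h2
  · show g.z = c - a * b / 2
    rw [← h3, h1, h2]; ring

/-- The global chart `(x, y, z)`; tangent vectors are written in the frame `∂x, ∂y, ∂z`. -/
def coords (g : Heisenberg) : ℝ × ℝ × ℝ := (g.x, g.y, g.z)

/-- The left-invariant vector field `X₁ = ∂x - (y / 2) ∂z`. -/
noncomputable def X₁ (g : Heisenberg) : ℝ × ℝ × ℝ := (1, 0, -(g.y / 2))

/-- The left-invariant vector field `X₂ = ∂y + (x / 2) ∂z`. -/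
noncomputable def X₂ (g : Heisenberg) : ℝ × ℝ × ℝ := (0, 1, g.x / 2)

/-- The distribution spanned by `X₁` and `X₂`. -/
noncomputable def distribution (g : Heisenberg) : Submodule ℝ (ℝ × ℝ × ℝ) :=
  Submodule.span ℝ {X₁ g, X₂ g}

/-- The inner product on `distribution g` for which `X₁ g`, `X₂ g` are orthonormal: the
coefficients of a horizontal vector `v` in this frame are its first two components. It is only
used for vectors of the distribution. -/
def horizontalInner (v w : ℝ × ℝ × ℝ) : ℝ := v.1 * w.1 + v.2.1 * w.2.1

theorem horizontalInner_frame (g : Heisenberg) (u₁ u₂ w₁ w₂ : ℝ) :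
    horizontalInner (u₁ • X₁ g + u₂ • X₂ g) (w₁ • X₁ g + w₂ • X₂ g) = u₁ * w₁ + u₂ * w₂ := by
  simp [horizontalInner, X₁, X₂]

/-- `q`, restricted to `[0, t₁]`, is a horizontal curve: it is Lipschitz, and its velocity lies in
the distribution at almost every time. (Values of `q` outside `[0, t₁]` play no role. On a compact
interval, being Lipschitz does not depend on the chart.) -/
structure IsHorizontalCurve (t₁ : ℝ) (q : ℝ → Heisenberg) : Prop where
  lipschitz : ∃ K : ℝ≥0, LipschitzOnWith K (fun t => (q t).coords) (Icc 0 t₁)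
  horizontal : ∀ᵐ t ∂(volume.restrict (Icc 0 t₁)),
    ∃ v ∈ distribution (q t), HasDerivAt (fun s => (q s).coords) v t

/-- The sub-Riemannian length of a curve on `[0, t₁]`. -/
noncomputable def srLength (t₁ : ℝ) (q : ℝ → Heisenberg) : ℝ :=
  ∫ t in (0 : ℝ)..t₁,
    √(horizontalInner (deriv (fun s => (q s).coords) t) (deriv (fun s => (q s).coords) t))

/-- The lengths of all horizontal curves from `g₀` to `g₁`. -/
def horizontalLengths (g₀ g₁ : Heisenberg) : Set ℝ :=
  {l | ∃ (t₁ : ℝ) (q : ℝ → Heisenberg), 0 < t₁ ∧ IsHorizontalCurve t₁ q ∧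
    q 0 = g₀ ∧ q t₁ = g₁ ∧ l = srLength t₁ q}

/-- The sub-Riemannian (Carnot–Carathéodory) distance. -/
noncomputable def srDist (g₀ g₁ : Heisenberg) : ℝ := sInf (horizontalLengths g₀ g₁)

end Heisenberg

/-! Horizontality makes `z` the signed area swept by the projection to the plane, whose Euclidean
length is the sub-Riemannian length `ℓ`. The lower bound is thus the planar inequality `12 z² ≤ ℓ²
(ℓ² - r²)`, solved as a quadratic inequality in `ℓ²`.

Rotate the endpoint to `(R, 0)`. Integration by parts gives `z = ∫ (P - const) dQ`, for any
constant, and Cauchy–Schwarz in arc length bounds `z²` by `∫ (P - const)²` times `D = ∫ η²`, where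
`(ξ, η)` is the unit tangent. Split `P` into uniform motion of slope `e = R / ℓ` and a remainder
vanishing at both ends; the remainder is controlled by `S = ∫ (ξ - e)²` through
`IsACPrimitive.sq_sub_mean_le`. Since `ξ² + η² = 1`, `D + S = ℓ (1 - e²)`, and `area_bound_of_split`
finishes (`sq_area_le_of_end_on_axis`).

The upper bound comes from an explicit competitor, a lifted trochoid, whose length is estimated by
its energy. -/

/-! ### Calculus of absolutely continuous primitives. -/

/-- `F` is absolutely continuous on the interval with endpoints `a`, `b`, with almost everywhere
derivative `f`. -/
structure IsACPrimitive (F f : ℝ → ℝ) (a b : ℝ) : Prop where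
  ac : AbsolutelyContinuousOnInterval F a b
  hasDerivAt : ∀ᵐ t, t ∈ uIcc a b → HasDerivAt F (f t) t

namespace IsACPrimitive

variable {F G f g : ℝ → ℝ} {a b : ℝ}

theorem deriv_ae_eq (hF : IsACPrimitive F f a b) :
    deriv F =ᵐ[volume.restrict (uIoc a b)] f := by
  rw [Filter.EventuallyEq, ae_restrict_iff' measurableSet_uIoc]
  filter_upwards [hF.hasDerivAt] with t ht h
  exact (ht (uIoc_subset_uIcc h)).deriv

theorem intervalIntegrable (hF : IsACPrimitive F f a b) : IntervalIntegrable f volume a b :=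
  hF.ac.intervalIntegrable_deriv.congr_ae hF.deriv_ae_eq

theorem integral_eq (hF : IsACPrimitive F f a b) : ∫ t in a..b, f t = F b - F a := by
  rw [← hF.ac.integral_deriv_eq_sub]
  refine intervalIntegral.integral_congr_ae ?_
  filter_upwards [hF.hasDerivAt] with t ht h
  exact (ht (uIoc_subset_uIcc h)).deriv.symm

theorem continuousOn (hF : IsACPrimitive F f a b) : ContinuousOn F (uIcc a b) :=
  hF.ac.continuousOn

theorem mono {c d : ℝ} (hF : IsACPrimitive F f a b) (h : uIcc c d ⊆ uIcc a b) :
    IsACPrimitive F f c d where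
  ac := hF.ac.mono h
  hasDerivAt := by
    filter_upwards [hF.hasDerivAt] with t ht h' using ht (h h')

theorem congr_deriv (hF : IsACPrimitive F f a b) (h : ∀ t, f t = g t) : IsACPrimitive F g a b := by
  rwa [← funext h]

theorem const (c a b : ℝ) : IsACPrimitive (fun _ => c) (fun _ => 0) a b where
  ac := (contDiff_const (n := 1)).contDiffOn.absolutelyContinuousOnInterval
  hasDerivAt := .of_forall fun t _ => hasDerivAt_const t c

theorem add (hF : IsACPrimitive F f a b) (hG : IsACPrimitive G g a b) :
    IsACPrimitive (fun t => F t + G t) (fun t => f t + g t) a b where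
  ac := hF.ac.fun_add hG.ac
  hasDerivAt := by
    filter_upwards [hF.hasDerivAt, hG.hasDerivAt] with t h1 h2 h using (h1 h).add (h2 h)

theorem sub (hF : IsACPrimitive F f a b) (hG : IsACPrimitive G g a b) :
    IsACPrimitive (fun t => F t - G t) (fun t => f t - g t) a b where
  ac := hF.ac.fun_sub hG.ac
  hasDerivAt := by
    filter_upwards [hF.hasDerivAt, hG.hasDerivAt] with t h1 h2 h using (h1 h).sub (h2 h)

theorem mul (hF : IsACPrimitive F f a b) (hG : IsACPrimitive G g a b) :
    IsACPrimitive (fun t => F t * G t) (fun t => f t * G t + F t * g t) a b where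
  ac := hF.ac.fun_mul hG.ac
  hasDerivAt := by
    filter_upwards [hF.hasDerivAt, hG.hasDerivAt] with t h1 h2 h using (h1 h).mul (h2 h)

theorem const_mul (c : ℝ) (hF : IsACPrimitive F f a b) :
    IsACPrimitive (fun t => c * F t) (fun t => c * f t) a b :=
  ((const c a b).mul hF).congr_deriv fun t => by ring

theorem of_intervalIntegrable (hf : IntervalIntegrable f volume a b) :
    IsACPrimitive (fun t => ∫ s in a..t, f s) f a b where
  ac := hf.absolutelyContinuousOnInterval_intervalIntegral left_mem_uIcc
  hasDerivAt := by
    filter_upwards [hf.ae_hasDerivAt_integral] with t ht h using ht h a left_mem_uIcc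

end IsACPrimitive

/-! ### Integral inequalities and the planar area bound. -/

/-- The Cauchy-Schwarz inequality for interval integrals with a nonnegative weight. -/
theorem intervalIntegral_weighted_cauchySchwarz {f g v : ℝ → ℝ} {a b : ℝ} (hab : a ≤ b)
    (hv : ∀ t, 0 ≤ v t)
    (hff : IntervalIntegrable (fun t => f t ^ 2 * v t) volume a b)
    (hfg : IntervalIntegrable (fun t => f t * g t * v t) volume a b)
    (hgg : IntervalIntegrable (fun t => g t ^ 2 * v t) volume a b) :
    (∫ t in a..b, f t * g t * v t) ^ 2 ≤
      (∫ t in a..b, f t ^ 2 * v t) * ∫ t in a..b, g t ^ 2 * v t := by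
  have key : ∀ x : ℝ, 0 ≤ (∫ t in a..b, f t ^ 2 * v t) * (x * x)
      + (2 * ∫ t in a..b, f t * g t * v t) * x + ∫ t in a..b, g t ^ 2 * v t := by
    intro x
    have h : 0 ≤ ∫ t in a..b, (f t ^ 2 * v t * (x * x) + f t * g t * v t * (2 * x))
        + g t ^ 2 * v t := by
      refine intervalIntegral.integral_nonneg hab fun t _ => ?_
      have := mul_nonneg (sq_nonneg (f t * x + g t)) (hv t)
      nlinarith
    rw [intervalIntegral.integral_add ((hff.mul_const _).add (hfg.mul_const _)) hgg,
      intervalIntegral.integral_add (hff.mul_const _) (hfg.mul_const _),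
      intervalIntegral.integral_mul_const, intervalIntegral.integral_mul_const] at h
    linarith
  have := discrim_le_zero key
  rw [discrim] at this
  nlinarith

/-- A function which vanishes at both ends of an interval deviates from its mean by at most the
`L²` norm of its derivative, up to a constant. Here the interval carries the measure
`v t dt` with primitive `σ`, and `w' = ζ v`. -/
theorem IsACPrimitive.sq_sub_mean_le {σ v w ζ : ℝ → ℝ} {T : ℝ}
    (hσ : IsACPrimitive σ v 0 T) (hw : IsACPrimitive w (fun t => ζ t * v t) 0 T)
    (hv : ∀ t, 0 ≤ v t) (hζ : IntervalIntegrable (fun t => ζ t ^ 2 * v t) volume 0 T)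
    (hσ0 : σ 0 = 0) (hw0 : w 0 = 0) (hwT : w T = 0) (s : ℝ) (hs : s ∈ Icc 0 T) :
    (σ T * w s - ∫ t in (0 : ℝ)..T, w t * v t) ^ 2 ≤
      σ T ^ 3 / 12 * ∫ t in (0 : ℝ)..T, ζ t ^ 2 * v t := by
  have hT : 0 ≤ T := hs.1.trans hs.2
  have hΩ := IsACPrimitive.of_intervalIntegrable
    (hσ.intervalIntegrable.continuousOn_mul hw.continuousOn)
  set Ω : ℝ → ℝ := fun t => ∫ s in (0 : ℝ)..t, w s * v s with hΩdef
  have hΩ0 : Ω 0 = 0 := by simp [hΩdef]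
  have sub1 : uIcc 0 s ⊆ uIcc 0 T := by
    rw [uIcc_of_le hs.1, uIcc_of_le hT]; exact Icc_subset_Icc_right hs.2
  have sub2 : uIcc s T ⊆ uIcc 0 T := by
    rw [uIcc_of_le hs.2, uIcc_of_le hT]; exact Icc_subset_Icc_left hs.1
  -- Integration by parts against the kernel `σ - k`, then Cauchy–Schwarz.
  have piece : ∀ c d k : ℝ, c ≤ d → uIcc c d ⊆ uIcc 0 T →
      (((σ d - k) * w d - Ω d) - ((σ c - k) * w c - Ω c)) ^ 2 ≤
      (((σ d - k) ^ 3 - (σ c - k) ^ 3) / 3) * ∫ t in c..d, ζ t ^ 2 * v t := by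
    intro c d k hcd hsub
    have hk := (hσ.sub (IsACPrimitive.const k 0 T)).mono hsub
    have h1 : IsACPrimitive (fun t => (σ t - k) * w t - Ω t)
        (fun t => (σ t - k) * ζ t * v t) c d :=
      ((hk.mul (hw.mono hsub)).sub (hΩ.mono hsub)).congr_deriv fun t => by ring
    have h2 : IsACPrimitive (fun t => 1 / 3 * ((σ t - k) * ((σ t - k) * (σ t - k))))
        (fun t => (σ t - k) ^ 2 * v t) c d :=
      ((hk.mul (hk.mul hk)).const_mul (1 / 3)).congr_deriv fun t => by ring
    have := intervalIntegral_weighted_cauchySchwarz hcd hv h2.intervalIntegrable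
      h1.intervalIntegrable (hζ.mono_set hsub)
    rw [h1.integral_eq, h2.integral_eq] at this
    refine this.trans_eq ?_
    ring
  -- The two shifts form a sawtooth kernel with a jump of size `σ T` at `s`. The left sides add up
  -- to `σ T * w s - Ω T`, and the squared norm of the kernel is `σ T ^ 3 / 12` whatever `s` is.
  have p1 := piece 0 s (σ s - σ T / 2) hs.1 sub1
  have p2 := piece s T (σ s + σ T / 2) hs.2 sub2
  have hadd := intervalIntegral.integral_add_adjacent_intervals (hζ.mono_set sub1)
    (hζ.mono_set sub2)
  have n1 : 0 ≤ ∫ t in (0 : ℝ)..s, ζ t ^ 2 * v t :=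
    intervalIntegral.integral_nonneg hs.1 fun t _ => mul_nonneg (sq_nonneg _) (hv t)
  have n2 : 0 ≤ ∫ t in s..T, ζ t ^ 2 * v t :=
    intervalIntegral.integral_nonneg hs.2 fun t _ => mul_nonneg (sq_nonneg _) (hv t)
  have σ1 : 0 ≤ σ s := by
    have := (hσ.mono sub1).integral_eq
    have h := intervalIntegral.integral_nonneg (μ := volume) hs.1 fun t _ => hv t
    linarith
  have σ2 : σ s ≤ σ T := by
    have := (hσ.mono sub2).integral_eq
    have h := intervalIntegral.integral_nonneg (μ := volume) hs.2 fun t _ => hv t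
    linarith
  rw [← hadd]
  change (σ T * w s - Ω T) ^ 2 ≤ _
  rw [hσ0, hw0, hΩ0] at p1
  rw [hwT] at p2
  have hA : 0 ≤ ((σ s - (σ s - σ T / 2)) ^ 3 - (0 - (σ s - σ T / 2)) ^ 3) / 3 := by
    have : (0 - (σ s - σ T / 2)) ^ 3 ≤ (σ s - (σ s - σ T / 2)) ^ 3 :=
      (Odd.strictMono_pow (by decide)).monotone (by linarith)
    linarith
  have hB : 0 ≤ ((σ T - (σ s + σ T / 2)) ^ 3 - (σ s - (σ s + σ T / 2)) ^ 3) / 3 := by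
    have : (σ s - (σ s + σ T / 2)) ^ 3 ≤ (σ T - (σ s + σ T / 2)) ^ 3 :=
      (Odd.strictMono_pow (by decide)).monotone (by linarith)
    linarith
  -- Two-term Cauchy–Schwarz, joining the two pieces.
  have cs : ∀ α β A B S₁ S₂ : ℝ, α ^ 2 ≤ A * S₁ → β ^ 2 ≤ B * S₂ → 0 ≤ A → 0 ≤ B → 0 ≤ S₁ →
      0 ≤ S₂ → (α + β) ^ 2 ≤ (A + B) * (S₁ + S₂) := by
    intro α β A B S₁ S₂ h1 h2 hA hB hS1 hS2
    have h3 : (2 * (α * β)) ^ 2 ≤ (A * S₂ + B * S₁) ^ 2 := by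
      have := mul_le_mul h1 h2 (sq_nonneg _) (mul_nonneg hA hS1)
      nlinarith [sq_nonneg (A * S₂ - B * S₁)]
    have h4 := (abs_le_of_sq_le_sq' h3 (by positivity)).2
    nlinarith
  refine le_of_eq_of_le ?_ ((cs _ _ _ _ _ _ p1 p2 hA hB n1 n2).trans_eq ?_) <;> ring

/-- AM-GM on the cross term gives `24 J D ≤ ℓ² (D² + S e² ℓ)`. The right side of `hz` times 12 is
then at most `ℓ² (D + S) (D + e² ℓ)`. -/
theorem area_bound_of_split {z ℓ e D S J : ℝ} (hℓ : 0 ≤ ℓ) (hD : 0 ≤ D) (hS : 0 ≤ S)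
    (hJ : J ^ 2 ≤ (e ^ 2 * ℓ ^ 3 / 12) * (ℓ ^ 2 * S / 12))
    (hz : z ^ 2 ≤ (e ^ 2 * ℓ ^ 3 / 12 + 2 * J + ℓ ^ 2 * S / 12) * D) :
    12 * z ^ 2 ≤ ℓ ^ 2 * ((D + S) * (D + S + e ^ 2 * ℓ)) := by
  have hJD : 24 * (J * D) ≤ ℓ ^ 2 * (D ^ 2 + S * (e ^ 2 * ℓ)) := by
    have h1 : (24 * (J * D)) ^ 2 ≤ (ℓ ^ 2 * (D ^ 2 + S * (e ^ 2 * ℓ))) ^ 2 := by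
      have h2 := mul_le_mul_of_nonneg_right hJ (sq_nonneg D)
      linarith [sq_nonneg (ℓ ^ 2 * (D ^ 2 - S * (e ^ 2 * ℓ)))]
    exact (abs_le_of_sq_le_sq' h1 (by positivity)).2
  have : 0 ≤ ℓ ^ 2 * (D * S + S ^ 2) := by positivity
  linarith

/-- A quadratic isoperimetric inequality for a plane curve `(P, Q)` with speed `v`, which
starts at the origin and ends on the first coordinate axis; `Z` is the area swept out and `σ` the
arc length. -/
theorem sq_area_le_of_end_on_axis {P Q Z σ p q v : ℝ → ℝ} {T : ℝ} (hT : 0 ≤ T)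
    (hP : IsACPrimitive P p 0 T) (hQ : IsACPrimitive Q q 0 T)
    (hZ : IsACPrimitive Z (fun t => (P t * q t - Q t * p t) / 2) 0 T)
    (hσ : IsACPrimitive σ v 0 T) (hp : Measurable p) (hq : Measurable q)
    (hv : ∀ t, v t = √(p t ^ 2 + q t ^ 2))
    (hP0 : P 0 = 0) (hQ0 : Q 0 = 0) (hZ0 : Z 0 = 0) (hσ0 : σ 0 = 0) (hQT : Q T = 0) :
    P T ^ 2 ≤ σ T ^ 2 ∧ 12 * Z T ^ 2 ≤ σ T ^ 2 * (σ T ^ 2 - P T ^ 2) := by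
  have hv0 : ∀ t, 0 ≤ v t := fun t => hv t ▸ Real.sqrt_nonneg _
  have hvsq : ∀ t, v t ^ 2 = p t ^ 2 + q t ^ 2 := fun t => by
    rw [hv t, Real.sq_sqrt (by positivity)]
  have hvm : Measurable v := by
    rw [funext hv]; fun_prop
  have hvi := hσ.intervalIntegrable
  -- Where the speed vanishes so do `p` and `q`, so the convention `x / 0 = 0` is harmless.
  have hpv : ∀ t, p t / v t * v t = p t := fun t => by
    rcases eq_or_ne (v t) 0 with h | h
    · have := hvsq t
      rw [h] at this ⊢
      nlinarith [sq_nonneg (p t), sq_nonneg (q t)]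
    · field_simp
  have hqv : ∀ t, q t / v t * v t = q t := fun t => by
    rcases eq_or_ne (v t) 0 with h | h
    · have := hvsq t
      rw [h] at this ⊢
      nlinarith [sq_nonneg (p t), sq_nonneg (q t)]
    · field_simp
  set ξ : ℝ → ℝ := fun t => p t / v t with hξ
  set η : ℝ → ℝ := fun t => q t / v t with hη
  have hsum : ∀ t, ξ t ^ 2 * v t + η t ^ 2 * v t = v t := fun t => by
    rcases eq_or_ne (v t) 0 with h | h
    · simp [h]
    · have : ξ t ^ 2 + η t ^ 2 = 1 := by
        simp only [hξ, hη, div_pow, ← add_div, ← hvsq t]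
        field_simp
      rw [← add_mul, this, one_mul]
  have hξi : IntervalIntegrable (fun t => ξ t ^ 2 * v t) volume 0 T := by
    refine hvi.mono_fun (by fun_prop) (.of_forall fun t => ?_)
    beta_reduce
    rw [Real.norm_of_nonneg (mul_nonneg (sq_nonneg _) (hv0 t)), Real.norm_of_nonneg (hv0 t)]
    linarith [hsum t, mul_nonneg (sq_nonneg (η t)) (hv0 t)]
  have hηi : IntervalIntegrable (fun t => η t ^ 2 * v t) volume 0 T := by
    refine hvi.mono_fun (by fun_prop) (.of_forall fun t => ?_)
    beta_reduce
    rw [Real.norm_of_nonneg (mul_nonneg (sq_nonneg _) (hv0 t)), Real.norm_of_nonneg (hv0 t)]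
    linarith [hsum t, mul_nonneg (sq_nonneg (ξ t)) (hv0 t)]
  set ℓ := σ T with hℓ
  set R := P T with hR
  have hℓint : ∫ t in (0 : ℝ)..T, v t = ℓ := by rw [hσ.integral_eq, hσ0, sub_zero]
  have hℓ0 : 0 ≤ ℓ := hℓint ▸ intervalIntegral.integral_nonneg hT fun t _ => hv0 t
  have hRℓ : R ^ 2 ≤ ℓ ^ 2 := by
    have h : |∫ t in (0 : ℝ)..T, p t| ≤ ∫ t in (0 : ℝ)..T, v t := by
      rw [← Real.norm_eq_abs]
      refine intervalIntegral.norm_integral_le_of_norm_le hT (.of_forall fun t _ => ?_) hvi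
      rw [Real.norm_eq_abs, hv t]
      exact Real.abs_le_sqrt (by nlinarith [sq_nonneg (q t)])
    rw [hP.integral_eq, hP0, sub_zero, hℓint] at h
    exact sq_le_sq' (by linarith [neg_abs_le R]) (by linarith [le_abs_self R])
  refine ⟨hRℓ, ?_⟩
  set D := ∫ t in (0 : ℝ)..T, η t ^ 2 * v t with hD
  have hD0 : 0 ≤ D := intervalIntegral.integral_nonneg hT fun t _ =>
    mul_nonneg (sq_nonneg _) (hv0 t)
  -- Zero length has no mean slope `R / ℓ`; there `D ≤ ℓ = 0` already forces the area to vanish.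
  rcases hℓ0.eq_or_lt with h0 | hpos
  · have hDℓ : D ≤ ℓ := hℓint ▸ intervalIntegral.integral_mono_on hT hηi hvi fun t _ => by
      linarith [hsum t, mul_nonneg (sq_nonneg (ξ t)) (hv0 t)]
    have hZP : IsACPrimitive (fun t => Z t + 1 / 2 * (P t * Q t)) (fun t => P t * η t * v t) 0 T :=
      (hZ.add ((hP.mul hQ).const_mul (1 / 2))).congr_deriv fun t => by
        rw [mul_assoc, hqv t]; ring
    have h := intervalIntegral_weighted_cauchySchwarz hT hv0
      (hvi.continuousOn_mul (hP.continuousOn.pow 2)) hZP.intervalIntegrable hηi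
    rw [hZP.integral_eq, hQT, hQ0, hZ0, ← hD, show D = 0 by linarith] at h
    rw [← h0]
    linarith
  set e := R / ℓ with he
  have heℓ : e * ℓ = R := by
    rw [he]; field_simp
  -- the deviation from uniform motion along the axis
  set w : ℝ → ℝ := fun t => P t - e * σ t with hwdef
  set ζ : ℝ → ℝ := fun t => ξ t - e with hζdef
  have hw : IsACPrimitive w (fun t => ζ t * v t) 0 T :=
    (hP.sub (hσ.const_mul e)).congr_deriv fun t => by
      simp only [hζdef, sub_mul]; rw [hpv t]
  have hw0 : w 0 = 0 := by simp [hwdef, hP0, hσ0]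
  have hwT : w T = 0 := by simp only [hwdef, ← hℓ, heℓ, ← hR, sub_self]
  have hζi : IntervalIntegrable (fun t => ζ t ^ 2 * v t) volume 0 T := by
    have h := (hξi.add (hP.intervalIntegrable.const_mul (-2 * e))).add (hvi.const_mul (e ^ 2))
    refine h.congr fun t _ => ?_
    simp only [hζdef]
    rw [show (ξ t - e) ^ 2 * v t = ξ t ^ 2 * v t - 2 * e * (ξ t * v t) + e ^ 2 * v t by ring, hpv t]
    ring
  set S := ∫ t in (0 : ℝ)..T, ζ t ^ 2 * v t with hS
  have hS0 : 0 ≤ S := intervalIntegral.integral_nonneg hT fun t _ =>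
    mul_nonneg (sq_nonneg _) (hv0 t)
  -- A variance identity: `e` is the mean of `ξ` in arc length and `ξ² + η² = 1` where the speed is
  -- nonzero.
  have hDS : D + S = ℓ - e ^ 2 * ℓ := by
    rw [hD, hS, ← intervalIntegral.integral_add hηi hζi]
    have h := ((hσ.sub (hP.const_mul (2 * e))).add (hσ.const_mul (e ^ 2))).integral_eq
    rw [hP0, hσ0, ← hℓ, ← hR, ← heℓ] at h
    have h' : ∀ t, η t ^ 2 * v t + ζ t ^ 2 * v t = v t - 2 * e * p t + e ^ 2 * v t := fun t => by
      simp only [hζdef]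
      rw [← hpv t]
      linear_combination hsum t
    simp only [h']
    linarith
  set M := ∫ t in (0 : ℝ)..T, w t * v t with hM
  have hdev := hσ.sq_sub_mean_le hw hv0 hζi hσ0 hw0 hwT
  rw [← hS, ← hM, ← hℓ] at hdev
  -- the two parts of `P`, up to constants
  set f : ℝ → ℝ := fun t => e * (σ t - ℓ / 2) with hf
  set m := M / ℓ with hm
  set g : ℝ → ℝ := fun t => w t - m with hg
  have hσc := hσ.sub (IsACPrimitive.const (ℓ / 2) 0 T)
  have hfP := hσc.const_mul e
  have hgP := hw.sub (IsACPrimitive.const m 0 T)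
  have hff : IsACPrimitive
      (fun t => e ^ 2 / 3 * ((σ t - ℓ / 2) * ((σ t - ℓ / 2) * (σ t - ℓ / 2))))
      (fun t => f t ^ 2 * v t) 0 T :=
    ((hσc.mul (hσc.mul hσc)).const_mul (e ^ 2 / 3)).congr_deriv fun t => by
      simp only [hf]; ring
  have hffint : ∫ t in (0 : ℝ)..T, f t ^ 2 * v t = e ^ 2 * ℓ ^ 3 / 12 := by
    rw [hff.integral_eq, hσ0, ← hℓ]; ring
  have hgi : IntervalIntegrable (fun t => g t ^ 2 * v t) volume 0 T :=
    hvi.continuousOn_mul (hgP.continuousOn.pow 2)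
  have hfgi : IntervalIntegrable (fun t => f t * g t * v t) volume 0 T :=
    hvi.continuousOn_mul (hfP.continuousOn.mul hgP.continuousOn)
  have hhi : IntervalIntegrable (fun t => (f t + g t) ^ 2 * v t) volume 0 T :=
    hvi.continuousOn_mul ((hfP.continuousOn.add hgP.continuousOn).pow 2)
  have hgint : ∫ t in (0 : ℝ)..T, g t ^ 2 * v t ≤ ℓ ^ 2 * S / 12 := by
    have hb : ∀ t ∈ Icc 0 T, g t ^ 2 * v t ≤ ℓ * S / 12 * v t := fun t ht => by
      refine mul_le_mul_of_nonneg_right ?_ (hv0 t)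
      have h1 := hdev t ht
      have h2 : ℓ * w t - M = ℓ * g t := by
        simp only [hg, hm]; field_simp
      rw [h2, mul_pow] at h1
      refine le_of_mul_le_mul_left (h1.trans_eq ?_) (pow_pos hpos 2)
      ring
    refine (intervalIntegral.integral_mono_on hT hgi (hvi.const_mul _) hb).trans_eq ?_
    rw [intervalIntegral.integral_const_mul, hℓint]; ring
  set J := ∫ t in (0 : ℝ)..T, f t * g t * v t with hJ
  have hJsq : J ^ 2 ≤ (e ^ 2 * ℓ ^ 3 / 12) * (ℓ ^ 2 * S / 12) := by
    refine (intervalIntegral_weighted_cauchySchwarz hT hv0 hff.intervalIntegrable hfgi hgi).trans ?_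
    rw [hffint]
    exact mul_le_mul_of_nonneg_left hgint (by positivity)
  have hhint : ∫ t in (0 : ℝ)..T, (f t + g t) ^ 2 * v t ≤
      e ^ 2 * ℓ ^ 3 / 12 + 2 * J + ℓ ^ 2 * S / 12 := by
    have h : ∀ t, (f t + g t) ^ 2 * v t = f t ^ 2 * v t + 2 * (f t * g t * v t) + g t ^ 2 * v t :=
      fun t => by ring
    simp only [h]
    rw [intervalIntegral.integral_add (hff.intervalIntegrable.add (hfgi.const_mul 2)) hgi,
      intervalIntegral.integral_add hff.intervalIntegrable (hfgi.const_mul 2),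
      intervalIntegral.integral_const_mul, hffint]
    linarith
  -- Shifting `P` by the constant `e ℓ / 2 + m` leaves the area unchanged because `Q` vanishes at
  -- both ends; `f + g` is the shifted `P`.
  have hZP : IsACPrimitive
      (fun t => Z t + 1 / 2 * (P t * Q t) - (e * (ℓ / 2) + m) * Q t)
      (fun t => (f t + g t) * η t * v t) 0 T :=
    ((hZ.add ((hP.mul hQ).const_mul (1 / 2))).sub (hQ.const_mul _)).congr_deriv fun t => by
      rw [mul_assoc, hqv t]; simp only [hf, hg, hwdef]; ring
  have hZsq := intervalIntegral_weighted_cauchySchwarz hT hv0 hhi hZP.intervalIntegrable hηi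
  rw [hZP.integral_eq, hQT, hQ0, hZ0, ← hD] at hZsq
  have hZ2 : Z T ^ 2 ≤ (e ^ 2 * ℓ ^ 3 / 12 + 2 * J + ℓ ^ 2 * S / 12) * D := by
    refine le_trans (le_of_eq ?_) (hZsq.trans (mul_le_mul_of_nonneg_right hhint hD0))
    ring
  have hgoal : ℓ ^ 2 * (ℓ ^ 2 - R ^ 2) = ℓ ^ 2 * ((D + S) * (D + S + e ^ 2 * ℓ)) := by
    rw [hDS, ← heℓ]; ring
  rw [hgoal]
  exact area_bound_of_split hpos.le hD0 hS0 hJsq hZ2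
-- Horizontal curves and the lower bound.
namespace Heisenberg

variable {T : ℝ} {q : ℝ → Heisenberg}

theorem mem_distribution_iff {g : Heisenberg} {v : ℝ × ℝ × ℝ} :
    v ∈ distribution g ↔ v.2.2 = (g.x * v.2.1 - g.y * v.1) / 2 := by
  obtain ⟨v₁, v₂, v₃⟩ := v
  simp only [distribution, Submodule.mem_span_pair, X₁, X₂, Prod.smul_mk, Prod.mk_add_mk,
    Prod.mk.injEq, smul_eq_mul]
  constructor
  · rintro ⟨a, b, rfl, rfl, rfl⟩
    ring
  · rintro rfl
    exact ⟨v₁, v₂, by ring, by ring, by ring⟩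

theorem hasDerivAt_coords_iff {v : ℝ × ℝ × ℝ} {t : ℝ} :
    HasDerivAt (fun s => (q s).coords) v t ↔ HasDerivAt (fun s => (q s).x) v.1 t ∧
      HasDerivAt (fun s => (q s).y) v.2.1 t ∧ HasDerivAt (fun s => (q s).z) v.2.2 t := by
  constructor
  · intro h
    exact ⟨h.fst, h.snd.fst, h.snd.snd⟩
  · rintro ⟨h1, h2, h3⟩
    exact h1.prodMk (h2.prodMk h3)

theorem IsHorizontalCurve.ae_hasDerivAt (hT : 0 ≤ T) (h : IsHorizontalCurve T q) :
    ∀ᵐ t, t ∈ uIcc 0 T → HasDerivAt (fun s => (q s).coords)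
      (deriv (fun s => (q s).x) t, deriv (fun s => (q s).y) t,
        ((q t).x * deriv (fun s => (q s).y) t - (q t).y * deriv (fun s => (q s).x) t) / 2) t := by
  have := h.horizontal
  rw [ae_restrict_iff' measurableSet_Icc] at this
  rw [uIcc_of_le hT]
  filter_upwards [this] with t ht hmem
  obtain ⟨v, hv, hd⟩ := ht hmem
  rw [mem_distribution_iff] at hv
  obtain ⟨h1, h2, h3⟩ := hasDerivAt_coords_iff.1 hd
  rw [h1.deriv, h2.deriv, ← hv]
  exact hd

/-- Reduces horizontal curves to the planar problem: the Lipschitz condition gives absolute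
continuity, horizontality the area form. -/
theorem IsHorizontalCurve.isACPrimitive (hT : 0 ≤ T) (h : IsHorizontalCurve T q) :
    IsACPrimitive (fun t => (q t).x) (deriv fun t => (q t).x) 0 T ∧
    IsACPrimitive (fun t => (q t).y) (deriv fun t => (q t).y) 0 T ∧
    IsACPrimitive (fun t => (q t).z) (fun t => ((q t).x * deriv (fun s => (q s).y) t -
      (q t).y * deriv (fun s => (q s).x) t) / 2) 0 T := by
  obtain ⟨K, hK⟩ := h.lipschitz
  rw [← uIcc_of_le hT] at hK
  have hd := h.ae_hasDerivAt hT
  refine ⟨⟨(LipschitzWith.prod_fst.comp_lipschitzOnWith hK).absolutelyContinuousOnInterval, ?_⟩,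
    ⟨(LipschitzWith.prod_fst.comp_lipschitzOnWith
      (LipschitzWith.prod_snd.comp_lipschitzOnWith hK)).absolutelyContinuousOnInterval, ?_⟩,
    ⟨(LipschitzWith.prod_snd.comp_lipschitzOnWith
      (LipschitzWith.prod_snd.comp_lipschitzOnWith hK)).absolutelyContinuousOnInterval, ?_⟩⟩
  · filter_upwards [hd] with t ht hmem using (hasDerivAt_coords_iff.1 (ht hmem)).1
  · filter_upwards [hd] with t ht hmem using (hasDerivAt_coords_iff.1 (ht hmem)).2.1
  · filter_upwards [hd] with t ht hmem using (hasDerivAt_coords_iff.1 (ht hmem)).2.2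

theorem IsHorizontalCurve.srLength_eq (hT : 0 ≤ T) (h : IsHorizontalCurve T q) :
    srLength T q = ∫ t in (0 : ℝ)..T,
      √(deriv (fun s => (q s).x) t ^ 2 + deriv (fun s => (q s).y) t ^ 2) := by
  refine intervalIntegral.integral_congr_ae ?_
  filter_upwards [h.ae_hasDerivAt hT] with t ht hmem
  rw [(ht (uIoc_subset_uIcc hmem)).deriv]
  simp only [horizontalInner, sq]

theorem srLength_nonneg (hT : 0 ≤ T) : 0 ≤ srLength T q :=
  intervalIntegral.integral_nonneg hT fun _ _ => Real.sqrt_nonneg _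

/-- Polar coordinates in the plane. -/
theorem _root_.exists_unit_vector_mul_sqrt (x y : ℝ) :
    ∃ c s : ℝ, c ^ 2 + s ^ 2 = 1 ∧ c * √(x ^ 2 + y ^ 2) = x ∧ s * √(x ^ 2 + y ^ 2) = y := by
  have hsq : √(x ^ 2 + y ^ 2) ^ 2 = x ^ 2 + y ^ 2 := Real.sq_sqrt (by positivity)
  rcases eq_or_ne (√(x ^ 2 + y ^ 2)) 0 with h | h
  · rw [h] at hsq ⊢
    exact ⟨1, 0, by norm_num, by nlinarith [sq_nonneg x, sq_nonneg y],
      by nlinarith [sq_nonneg x, sq_nonneg y]⟩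
  · refine ⟨x / √(x ^ 2 + y ^ 2), y / √(x ^ 2 + y ^ 2), ?_, by field_simp, by field_simp⟩
    rw [div_pow, div_pow, ← add_div, hsq, div_self (hsq ▸ pow_ne_zero 2 h)]

/-- A rotation of the plane preserves speed and the area form, so the endpoint may be moved to the
first axis. -/
theorem IsHorizontalCurve.sq_z_le {g : Heisenberg} (hT : 0 ≤ T) (h : IsHorizontalCurve T q)
    (h0 : q 0 = 1) (hg : q T = g) :
    g.x ^ 2 + g.y ^ 2 ≤ srLength T q ^ 2 ∧
      12 * g.z ^ 2 ≤ srLength T q ^ 2 * (srLength T q ^ 2 - (g.x ^ 2 + g.y ^ 2)) := by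
  obtain ⟨hX, hY, hZ⟩ := h.isACPrimitive hT
  obtain ⟨c, s, hcs, hc, hs⟩ := exists_unit_vector_mul_sqrt g.x g.y
  set r := √(g.x ^ 2 + g.y ^ 2) with hr
  have hrsq : r ^ 2 = g.x ^ 2 + g.y ^ 2 := Real.sq_sqrt (by positivity)
  set p := deriv fun t => (q t).x
  set p' := deriv fun t => (q t).y
  have hx0 : (q 0).x = 0 := by rw [h0, one_def]
  have hy0 : (q 0).y = 0 := by rw [h0, one_def]
  have hz0 : (q 0).z = 0 := by rw [h0, one_def]
  have hpm : Measurable p := measurable_deriv _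
  have hpm' : Measurable p' := measurable_deriv _
  have hnorm : ∀ t, √(p t ^ 2 + p' t ^ 2) =
      √((c * p t + s * p' t) ^ 2 + (c * p' t - s * p t) ^ 2) := fun t => by
    congr 1
    linear_combination (-(p t ^ 2 + p' t ^ 2)) * hcs
  have hvi : IntervalIntegrable (fun t => √(p t ^ 2 + p' t ^ 2)) volume 0 T := by
    refine (hX.intervalIntegrable.abs.add hY.intervalIntegrable.abs).mono_fun (by fun_prop)
      (.of_forall fun t => ?_)
    beta_reduce
    rw [Real.norm_of_nonneg (Real.sqrt_nonneg _)]
    refine le_trans ?_ (le_abs_self _)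
    refine Real.sqrt_le_iff.2 ⟨by positivity, ?_⟩
    nlinarith [sq_abs (p t), sq_abs (p' t), mul_nonneg (abs_nonneg (p t)) (abs_nonneg (p' t))]
  have hP := (hX.const_mul c).add (hY.const_mul s)
  have hQ := (hY.const_mul c).sub (hX.const_mul s)
  have hZ' : IsACPrimitive (fun t => (q t).z)
      (fun t => ((c * (q t).x + s * (q t).y) * (c * p' t - s * p t) -
        (c * (q t).y - s * (q t).x) * (c * p t + s * p' t)) / 2) 0 T :=
    hZ.congr_deriv fun t => by
      linear_combination (-((q t).x * p' t - (q t).y * p t) / 2) * hcs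
  have key := sq_area_le_of_end_on_axis hT hP hQ hZ' (IsACPrimitive.of_intervalIntegrable hvi)
    (by fun_prop) (by fun_prop) hnorm (by simp [hx0, hy0]) (by simp [hx0, hy0]) hz0 (by simp)
    (by rw [hg]; linear_combination s * hc - c * hs)
  rw [← h.srLength_eq hT, hg] at key
  have hR : (c * g.x + s * g.y) ^ 2 = g.x ^ 2 + g.y ^ 2 := by
    have : c * g.x + s * g.y = r := by linear_combination r * hcs - c * hc - s * hs
    rw [this, hrsq]
  rwa [hR] at key

theorem IsHorizontalCurve.sqrt_le_srLength {g : Heisenberg} {r : ℝ}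
    (hr : r ^ 2 = g.x ^ 2 + g.y ^ 2) (hT : 0 ≤ T)
    (h : IsHorizontalCurve T q) (h0 : q 0 = 1) (hg : q T = g) :
    √((√(r ^ 4 + 48 * g.z ^ 2) + r ^ 2) / 2) ≤ srLength T q := by
  obtain ⟨h1, h2⟩ := h.sq_z_le hT h0 hg
  rw [← hr] at h1 h2
  refine Real.sqrt_le_iff.2 ⟨srLength_nonneg hT, ?_⟩
  -- Completing the square in `srLength T q ^ 2`; `h1` makes the right side nonnegative.
  have : √(r ^ 4 + 48 * g.z ^ 2) ≤ 2 * srLength T q ^ 2 - r ^ 2 :=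
    Real.sqrt_le_iff.2 ⟨by nlinarith [sq_nonneg (srLength T q)], by linarith⟩
  linarith

/-! ### Trochoids and the upper bound. -/

/-- The trochoid in the plane, composed with the rotation with matrix `!![c, -s; s, c]`, lifted to
a horizontal curve. -/
noncomputable def trochoid (r k c s ε : ℝ) (t : ℝ) : Heisenberg where
  x := c * (r * t - k * Real.sin (2 * Real.pi * t)) -
    s * (ε * (k * (Real.cos (2 * Real.pi * t) - 1)))
  y := s * (r * t - k * Real.sin (2 * Real.pi * t)) +
    c * (ε * (k * (Real.cos (2 * Real.pi * t) - 1)))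
  -- The antiderivative, zero at `t = 0`, of the area form along the unrotated trochoid; `ε` is the
  -- orientation.
  z := ε / 2 * (k * r * (t * Real.cos (2 * Real.pi * t)) + k * (2 * Real.pi * k + r) * t -
    k * (2 * r + 2 * Real.pi * k) / (2 * Real.pi) * Real.sin (2 * Real.pi * t))

theorem hasDerivAt_coords_trochoid (r k c s ε t : ℝ) (hcs : c ^ 2 + s ^ 2 = 1) :
    ∃ v ∈ distribution (trochoid r k c s ε t),
      HasDerivAt (fun t => (trochoid r k c s ε t).coords) v t ∧
      horizontalInner v v = (r - 2 * Real.pi * k * Real.cos (2 * Real.pi * t)) ^ 2 +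
        ε ^ 2 * (2 * Real.pi * k * Real.sin (2 * Real.pi * t)) ^ 2 := by
  have hlin : HasDerivAt (fun t : ℝ => 2 * Real.pi * t) (2 * Real.pi) t := by
    simpa using (hasDerivAt_id t).const_mul (2 * Real.pi)
  have hsin := hlin.sin
  have hcos := hlin.cos
  have hP := ((hasDerivAt_id' t).const_mul r).sub (hsin.const_mul k)
  have hQ := ((hcos.sub_const 1).const_mul k).const_mul ε
  have hx := (hP.const_mul c).sub (hQ.const_mul s)
  have hy := (hP.const_mul s).add (hQ.const_mul c)
  have hz := (((((hasDerivAt_id' t).mul hcos).const_mul (k * r)).add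
    ((hasDerivAt_id' t).const_mul (k * (2 * Real.pi * k + r)))).sub
      (hsin.const_mul (k * (2 * r + 2 * Real.pi * k) / (2 * Real.pi)))).const_mul (ε / 2)
  refine ⟨(_, _, _), ?_, hasDerivAt_coords_iff.2 ⟨hx, hy, hz⟩, ?_⟩
  · rw [mem_distribution_iff]
    simp only [trochoid]
    have hN : k * (2 * r + 2 * Real.pi * k) / (2 * Real.pi) * (2 * Real.pi) =
      k * (2 * r + 2 * Real.pi * k) := div_mul_cancel₀ _ (by positivity)
    have h1 := Real.sin_sq_add_cos_sq (2 * Real.pi * t)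
    generalize Real.sin (2 * Real.pi * t) = S at *
    generalize Real.cos (2 * Real.pi * t) = C at *
    linear_combination (-(ε / 2) * C) * hN - ε * Real.pi * k ^ 2 * h1 -
      ((r * t - k * S) * (ε * (k * (-S * (2 * Real.pi)))) -
        ε * (k * (C - 1)) * (r - k * (C * (2 * Real.pi)))) / 2 * hcs
  · simp only [horizontalInner]
    linear_combination ((r - 2 * Real.pi * k * Real.cos (2 * Real.pi * t)) ^ 2 +
        ε ^ 2 * (2 * Real.pi * k * Real.sin (2 * Real.pi * t)) ^ 2) * hcs

theorem isHorizontalCurve_trochoid (r k c s ε T : ℝ) (hcs : c ^ 2 + s ^ 2 = 1) :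
    IsHorizontalCurve T (trochoid r k c s ε) where
  lipschitz := by
    have : ContDiff ℝ 1 fun t => (trochoid r k c s ε t).coords := by
      simp only [trochoid, coords]
      fun_prop
    exact this.contDiffOn.exists_lipschitzOnWith one_ne_zero (convex_Icc 0 T) isCompact_Icc
  horizontal := .of_forall fun t => by
    obtain ⟨v, hv, hd, -⟩ := hasDerivAt_coords_trochoid r k c s ε t hcs
    exact ⟨v, hv, hd⟩

theorem srLength_trochoid_le (r k c s ε : ℝ) (hcs : c ^ 2 + s ^ 2 = 1) (hε : ε ^ 2 = 1) :
    srLength 1 (trochoid r k c s ε) ≤ √(r ^ 2 + (2 * Real.pi * k) ^ 2) := by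
  set A : ℝ → ℝ := fun t =>
    r ^ 2 + (2 * Real.pi * k) ^ 2 - 2 * r * k * (2 * Real.pi * Real.cos (2 * Real.pi * t))
  have hA : ∀ t, horizontalInner (deriv (fun s' => (trochoid r k c s ε s').coords) t)
      (deriv (fun s' => (trochoid r k c s ε s').coords) t) = A t := fun t => by
    obtain ⟨v, -, hd, hn⟩ := hasDerivAt_coords_trochoid r k c s ε t hcs
    rw [hd.deriv, hn, hε]
    linear_combination (2 * Real.pi * k) ^ 2 * Real.sin_sq_add_cos_sq (2 * Real.pi * t)
  have hA0 : ∀ t, 0 ≤ A t := fun t => by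
    rw [← hA]; exact add_nonneg (mul_self_nonneg _) (mul_self_nonneg _)
  have hAc : Continuous A := by fun_prop
  have hint : ∫ t in (0 : ℝ)..1, A t = r ^ 2 + (2 * Real.pi * k) ^ 2 := by
    have hd : ∀ t ∈ uIcc (0 : ℝ) 1, HasDerivAt (fun t => (r ^ 2 + (2 * Real.pi * k) ^ 2) * t -
        2 * r * k * Real.sin (2 * Real.pi * t)) (A t) t := fun t _ => by
      have hlin : HasDerivAt (fun t : ℝ => 2 * Real.pi * t) (2 * Real.pi) t := by
        simpa using (hasDerivAt_id t).const_mul (2 * Real.pi)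
      refine (((hasDerivAt_id' t).const_mul _).sub (hlin.sin.const_mul _)).congr_deriv ?_
      simp only [A]; ring
    rw [intervalIntegral.integral_eq_sub_of_hasDerivAt hd (hAc.intervalIntegrable 0 1)]
    simp
  -- Length squared is at most energy on a unit time interval; the cosine term of `A` integrates to
  -- zero.
  have hcsw := intervalIntegral_weighted_cauchySchwarz (f := fun t => √(A t)) (g := fun _ => 1)
    (v := fun _ => 1) zero_le_one (fun _ => zero_le_one)
    (Continuous.intervalIntegrable (by fun_prop) 0 1)
    (Continuous.intervalIntegrable (by fun_prop) 0 1)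
    (Continuous.intervalIntegrable (by fun_prop) 0 1)
  simp only [mul_one, Real.sq_sqrt (hA0 _), hint] at hcsw
  simp only [srLength, hA]
  refine Real.le_sqrt_of_sq_le (hcsw.trans_eq ?_)
  simp

theorem exists_horizontalCurve_le (g : Heisenberg) (r : ℝ) (hr : r = √(g.x ^ 2 + g.y ^ 2)) :
    ∃ l ∈ horizontalLengths 1 g,
      l ≤ √((√(r ^ 4 + 64 * Real.pi ^ 2 * g.z ^ 2) + r ^ 2) / 2) := by
  obtain ⟨c, s, hcs, hc, hs⟩ := exists_unit_vector_mul_sqrt g.x g.y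
  rw [← hr] at hc hs
  have hr0 : 0 ≤ r := hr ▸ Real.sqrt_nonneg _
  have hπ := Real.pi_pos
  obtain ⟨ε, hε, hεz⟩ : ∃ ε : ℝ, ε ^ 2 = 1 ∧ ε * |g.z| = g.z := by
    rcases le_total 0 g.z with h | h
    · exact ⟨1, by norm_num, by rw [abs_of_nonneg h, one_mul]⟩
    · exact ⟨-1, by norm_num, by rw [abs_of_nonpos h]; ring⟩
  -- With `ρ = 2πk`, the height at time 1 is `ε ρ (ρ + 2r) / (4π)`; this choice makes it `g.z`.
  obtain ⟨ρ, hρ0, hρ⟩ : ∃ ρ : ℝ, 0 ≤ ρ ∧ ρ * (ρ + 2 * r) = 4 * Real.pi * |g.z| := by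
    have h0 : 0 ≤ 4 * Real.pi * |g.z| := by positivity
    refine ⟨√(r ^ 2 + 4 * Real.pi * |g.z|) - r, ?_, ?_⟩
    · exact sub_nonneg.2 (Real.le_sqrt_of_sq_le (by linarith))
    · linear_combination Real.sq_sqrt (show 0 ≤ r ^ 2 + 4 * Real.pi * |g.z| by positivity)
  obtain ⟨k, hk⟩ : ∃ k : ℝ, 2 * Real.pi * k = ρ := ⟨ρ / (2 * Real.pi), by field_simp⟩
  refine ⟨srLength 1 (trochoid r k c s ε), ⟨1, _, one_pos,
    isHorizontalCurve_trochoid r k c s ε 1 hcs, ?_, ?_, rfl⟩, ?_⟩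
  · simp [trochoid, one_def]
  · ext
    · simp [trochoid, hc]
    · simp [trochoid, hs]
    · simp only [trochoid, mul_one, Real.cos_two_pi, Real.sin_two_pi, mul_zero, sub_zero]
      rw [← hk] at hρ
      rw [← hεz]
      have : k * (2 * Real.pi * k + 2 * r) = 2 * |g.z| := by
        refine mul_left_cancel₀ (mul_ne_zero two_ne_zero hπ.ne') ?_
        linear_combination hρ
      linear_combination ε / 2 * this
  · refine (srLength_trochoid_le r k c s ε hcs hε).trans (Real.sqrt_le_sqrt ?_)
    rw [hk]
    -- Equivalent to bounding the energy `r² + ρ²` by half of `√(r⁴ + 64π²z²) + r²`.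
    have : r ^ 2 + 2 * ρ ^ 2 ≤ √(r ^ 4 + 64 * Real.pi ^ 2 * g.z ^ 2) := by
      refine Real.le_sqrt_of_sq_le ?_
      have h1 : 64 * Real.pi ^ 2 * g.z ^ 2 = 4 * (ρ * (ρ + 2 * r)) ^ 2 := by
        rw [hρ, ← sq_abs g.z]; ring
      rw [h1]
      have : 0 ≤ 16 * r * ρ ^ 3 + 12 * r ^ 2 * ρ ^ 2 := by positivity
      linarith
    linarith

end Heisenberg
/-- The first conjunct says that `g` can be joined to the identity by a horizontal curve, so that
the infimum defining the distance is over a non-empty set. -/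
theorem mainTheorem7 (g : Heisenberg) (r : ℝ) (hr : r = √(g.x ^ 2 + g.y ^ 2)) :
    (Heisenberg.horizontalLengths 1 g).Nonempty ∧
    √((√(r ^ 4 + 48 * g.z ^ 2) + r ^ 2) / 2) ≤ Heisenberg.srDist 1 g ∧
    Heisenberg.srDist 1 g ≤ √((√(r ^ 4 + 64 * Real.pi ^ 2 * g.z ^ 2) + r ^ 2) / 2) ∧
    r ≤ Heisenberg.srDist 1 g ∧
    (12 * g.z ^ 2) ^ (1 / 4 : ℝ) ≤ Heisenberg.srDist 1 g := by
  obtain ⟨l, hl, hle⟩ := Heisenberg.exists_horizontalCurve_le g r hr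
  have hrsq : r ^ 2 = g.x ^ 2 + g.y ^ 2 := by rw [hr, Real.sq_sqrt (by positivity)]
  have hlower : √((√(r ^ 4 + 48 * g.z ^ 2) + r ^ 2) / 2) ≤ Heisenberg.srDist 1 g := by
    refine le_csInf ⟨l, hl⟩ ?_
    rintro _ ⟨T, q, hT, hq, h0, h1, rfl⟩
    exact hq.sqrt_le_srLength hrsq hT.le h0 h1
  refine ⟨⟨l, hl⟩, hlower, ?_, ?_, ?_⟩
  · refine (csInf_le ⟨0, ?_⟩ hl).trans hle
    rintro _ ⟨T, q, hT, -, -, -, rfl⟩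
    exact Heisenberg.srLength_nonneg hT.le
  · refine le_trans (Real.le_sqrt_of_sq_le ?_) hlower
    have : r ^ 2 ≤ √(r ^ 4 + 48 * g.z ^ 2) :=
      Real.le_sqrt_of_sq_le (by nlinarith [sq_nonneg g.z])
    linarith
  · refine le_trans ?_ hlower
    rw [show (1 / 4 : ℝ) = 1 / 2 * (1 / 2) by norm_num, Real.rpow_mul (by positivity),
      ← Real.sqrt_eq_rpow, ← Real.sqrt_eq_rpow]
    refine Real.sqrt_le_sqrt ?_
    have : 2 * √(12 * g.z ^ 2) ≤ √(r ^ 4 + 48 * g.z ^ 2) := by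
      refine Real.le_sqrt_of_sq_le ?_
      rw [mul_pow, Real.sq_sqrt (by positivity)]
      nlinarith [sq_nonneg (r ^ 2)]
    nlinarith [sq_nonneg r]
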